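/- A \emph{partition scenario} is a set $\Xi$ with a set of partitions of $\Xi$ into non-empty sets, called measurements. The members of a measurement $M$ are its (fine-grained) outcomes, and the unions of members of $M$ are its coarse-grained outcomes. Two fine-grained outcomes are \emph{exclusive} if they are disjoint and belong to a common measurement. A \emph{probability function} $P$ assigns a number to every coarse-grained outcome of every measurement, in such a way that for each measurement it is a probability measure on the algebra of coarse-grained outcomes. It is \emph{non-contextual} if it is the restriction of a probability distribution on $\Xi$. A \emph{joint quantum measure} for $P$ is a function $\mu:2^\Xi\to\mathbb R_{\ge0}$ that agrees with $P$ on all coarse-grained outcomes and satisfies, for pairwise disjoint $A,B,C\subseteq\Xi$, $$\mu(A)+\mu(B)+\mu(C)-\mu(A\cup B)-\mu(B\cup C)-\mu(C\cup A)+\mu(A\cup B\cup C)=0 .$$ The joint scenario of two copies of a partition scenario on $\Xi$ lives on $\Xi\times\Xi$; its measurements are those in which one copy is measured first and the measurement on the other copy may depend on the outcome. \emph{Two independent copies} of $P$ are the probability function $P_2$ on the joint scenario with $P_2(A\times B)=P(A)P(B)$ for all fine-grained outcomes $A,B$. The \emph{Bell scenario} with $n$ parties, two inputs and two outputs has $\Xi=\{0,1\}^{n\times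 2}$ (one bit for each party and input); its measurements open the bits one after another, the next choice being a function of the earlier results, until exactly one bit of every party has been opened. The event that the parties output $a$ on input $x$ is $\{\gamma\in\Xi:\gamma(i,x_i)=a_i\ \forall i\}$, and $P(a|x)$ is its probability. For $n=2$ this is the CHSH scenario. \textbf{Corollary.} (i) Let $A_1,\dots,A_5$ be fine-grained outcomes of a partition scenario such that exactly the cyclically neighbouring pairs $\{A_i,A_{i+1}\}$ are exclusive (a Wright pentagon), and let $P$ be a probability function. If two independent copies of $P$ admit a joint quantum measure, then the quantum bound on the KCBS expression holds: $\sum_{i=1}^5P(A_i)\le\sqrt5$. (ii) Let $P$ be a probability function on the CHSH scenario, and $E_{xy}=\sum_{a,b\in\{0,1\}}(-1)^{a+b}P(ab|xy)$. If two independent copies of $P$ admit a joint quantum measure, then, for each choice of inputs $x_0,y_0\in\{0,1\}$, the CHSH expression obeys $$\Big|\sum_{x,y\in\{0,1\}}(-1)^{[x=x_0,\,y=y_0]}E_{xy}\Big|\le\frac{4(\sqrt{10}-1)}3\approx 2.883 .$$ (iii) Let $P$ be a probability function on the $n$-party Bell scenario that admits a joint quantum measure, and let $q$ be a probability distribution on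 the inputs $\{0,1\}^n$. In the game Guess Your Neighbour's Input, where $P$ wins with probability $\sum_x q(x)\,P(a_i=x_{i+1}\ \forall i\,|\,x)$ (indices cyclic), there is a non-contextual probability function that wins with at least the same probability. -/

import Mathlib

/-- A partition scenario on the sample space `Ξ`: every measurement is a partition of `Ξ` into
non-empty sets, its fine-grained outcomes. -/
structure PartitionScenario (Ξ : Type*) where
  measurements : Set (Set (Set Ξ))
  isPartition : ∀ M ∈ measurements, Setoid.IsPartition M

/-- The coarse-grained outcomes of one measurement `M`: the unions of fine-grained outcomes. -/
def coarseAlgebra {Ξ : Type*} (M : Set (Set Ξ)) : Set (Set Ξ) :=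
  {C | ∃ T ⊆ M, C = ⋃₀ T}

namespace PartitionScenario

/-- The fine-grained outcomes of all measurements. -/
def fineOutcomes {Ξ : Type*} (S : PartitionScenario Ξ) : Set (Set Ξ) :=
  {A | ∃ M ∈ S.measurements, A ∈ M}

/-- The coarse-grained outcomes of all measurements. -/
def outcomes {Ξ : Type*} (S : PartitionScenario Ξ) : Set (Set Ξ) :=
  {C | ∃ M ∈ S.measurements, C ∈ coarseAlgebra M}

/-- Two outcomes are exclusive if they are disjoint fine-grained outcomes of one measurement. -/
def Exclusive {Ξ : Type*} (S : PartitionScenario Ξ) (A B : Set Ξ) : Prop :=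
  Disjoint A B ∧ ∃ M ∈ S.measurements, A ∈ M ∧ B ∈ M

/-- `P` is a probability function: for every measurement `M`, it restricts to a (countably
additive) probability measure on the Boolean algebra of coarse-grained outcomes of `M`.
An outcome shared by two measurements is one set, so it has one probability. The values of `P`
on sets that are not outcomes are irrelevant. -/
structure IsProbabilityFunction {Ξ : Type*} (S : PartitionScenario Ξ) (P : Set Ξ → ℝ) :
    Prop where
  nonneg : ∀ C ∈ S.outcomes, 0 ≤ P C
  total : ∀ M ∈ S.measurements, P (⋃₀ M) = 1
  additive : ∀ M ∈ S.measurements, ∀ f : ℕ → Set Ξ, (∀ n, f n ∈ coarseAlgebra M) →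
    Pairwise (fun m n => Disjoint (f m) (f n)) → HasSum (fun n => P (f n)) (P (⋃ n, f n))

/-- Non-contextuality: the probabilities come from a joint probability distribution on `Ξ`. -/
def NonContextual {Ξ : Type*} (S : PartitionScenario Ξ) (P : Set Ξ → ℝ) : Prop :=
  ∃ (_ : MeasurableSpace Ξ) (ν : MeasureTheory.Measure Ξ), MeasureTheory.IsProbabilityMeasure ν ∧
    ∀ C ∈ S.outcomes, MeasurableSet C ∧ ν.real C = P C

/-- `μ` is a joint quantum measure for `P`: a non-negative function on all subsets of `Ξ` that
agrees with `P` on all outcomes and obeys the Sorkin sum rule. -/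
structure IsJointQuantumMeasure {Ξ : Type*} (S : PartitionScenario Ξ) (P μ : Set Ξ → ℝ) :
    Prop where
  nonneg : ∀ A, 0 ≤ μ A
  agrees : ∀ C ∈ S.outcomes, μ C = P C
  sorkin : ∀ A B C : Set Ξ, Disjoint A B → Disjoint B C → Disjoint C A →
    μ A + μ B + μ C - μ (A ∪ B) - μ (B ∪ C) - μ (C ∪ A) + μ (A ∪ B ∪ C) = 0

def AdmitsJointQuantumMeasure {Ξ : Type*} (S : PartitionScenario Ξ) (P : Set Ξ → ℝ) : Prop :=
  ∃ μ : Set Ξ → ℝ, S.IsJointQuantumMeasure P μ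

end PartitionScenario

/-- The partition of `Ξ × Ξ'` for the branching measurement that first performs `M` on the first
system and, on obtaining `A`, performs `N A` on the second system. -/
def branchFirst {Ξ Ξ' : Type*} (M : Set (Set Ξ)) (N : Set Ξ → Set (Set Ξ')) :
    Set (Set (Ξ × Ξ')) :=
  {D | ∃ A ∈ M, ∃ B ∈ N A, D = A ×ˢ B}

/-- The same with the second system measured first. -/
def branchSecond {Ξ Ξ' : Type*} (M : Set (Set Ξ')) (N : Set Ξ' → Set (Set Ξ)) :
    Set (Set (Ξ × Ξ')) :=
  {D | ∃ B ∈ M, ∃ A ∈ N B, D = A ×ˢ B}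

theorem isPartition_branchFirst {Ξ Ξ' : Type*} {M : Set (Set Ξ)} {N : Set Ξ → Set (Set Ξ')}
    (hM : Setoid.IsPartition M) (hN : ∀ A ∈ M, Setoid.IsPartition (N A)) :
    Setoid.IsPartition (branchFirst M N) := by
  refine ⟨?_, ?_⟩
  · rintro ⟨A, hA, B, hB, h⟩
    rcases Set.prod_eq_empty_iff.1 h.symm with h | h
    · exact hM.1 (h ▸ hA)
    · exact (hN A hA).1 (h ▸ hB)
  · rintro ⟨x, y⟩
    obtain ⟨A, ⟨hA, hx⟩, hAu⟩ := hM.2 x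
    obtain ⟨B, ⟨hB, hy⟩, hBu⟩ := (hN A hA).2 y
    refine ⟨A ×ˢ B, ⟨⟨A, hA, B, hB, rfl⟩, hx, hy⟩, ?_⟩
    rintro D ⟨⟨A', hA', B', hB', rfl⟩, hx', hy'⟩
    obtain rfl := hAu A' ⟨hA', hx'⟩
    obtain rfl := hBu B' ⟨hB', hy'⟩
    rfl

theorem isPartition_branchSecond {Ξ Ξ' : Type*} {M : Set (Set Ξ')} {N : Set Ξ' → Set (Set Ξ)}
    (hM : Setoid.IsPartition M) (hN : ∀ B ∈ M, Setoid.IsPartition (N B)) :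
    Setoid.IsPartition (branchSecond M N) := by
  refine ⟨?_, ?_⟩
  · rintro ⟨B, hB, A, hA, h⟩
    rcases Set.prod_eq_empty_iff.1 h.symm with h | h
    · exact (hN B hB).1 (h ▸ hA)
    · exact hM.1 (h ▸ hB)
  · rintro ⟨x, y⟩
    obtain ⟨B, ⟨hB, hy⟩, hBu⟩ := hM.2 y
    obtain ⟨A, ⟨hA, hx⟩, hAu⟩ := (hN B hB).2 x
    refine ⟨A ×ˢ B, ⟨⟨B, hB, A, hA, rfl⟩, hx, hy⟩, ?_⟩
    rintro D ⟨⟨B', hB', A', hA', rfl⟩, hx', hy'⟩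
    obtain rfl := hBu B' ⟨hB', hy'⟩
    obtain rfl := hAu A' ⟨hA', hx'⟩
    rfl

namespace PartitionScenario

/-- The joint scenario of two separated systems: one system is measured, and the measurement on
the other one may depend on the outcome (product measurements are the case of no dependence). -/
def prod {Ξ Ξ' : Type*} (S : PartitionScenario Ξ) (T : PartitionScenario Ξ') :
    PartitionScenario (Ξ × Ξ') where
  measurements :=
    {L | ∃ M ∈ S.measurements, ∃ N : Set Ξ → Set (Set Ξ'),
        (∀ A ∈ M, N A ∈ T.measurements) ∧ L = branchFirst M N} ∪
    {L | ∃ M ∈ T.measurements, ∃ N : Set Ξ' → Set (Set Ξ),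
        (∀ B ∈ M, N B ∈ S.measurements) ∧ L = branchSecond M N}
  isPartition := by
    rintro L (⟨M, hM, N, hN, rfl⟩ | ⟨M, hM, N, hN, rfl⟩)
    · exact isPartition_branchFirst (S.isPartition M hM) fun A hA => T.isPartition _ (hN A hA)
    · exact isPartition_branchSecond (T.isPartition M hM) fun B hB => S.isPartition _ (hN B hB)

/-- `P₂` is the probability function of two independent copies of `P`: the joint probability of a
pair of fine-grained outcomes is the product of their probabilities. This fixes `P₂` on all
outcomes of the joint scenario. -/
structure IsTwoIndependentCopies {Ξ : Type*} (S : PartitionScenario Ξ) (P : Set Ξ → ℝ)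
    (P₂ : Set (Ξ × Ξ) → ℝ) : Prop where
  single : S.IsProbabilityFunction P
  joint : (S.prod S).IsProbabilityFunction P₂
  indep : ∀ A ∈ S.fineOutcomes, ∀ B ∈ S.fineOutcomes, P₂ (A ×ˢ B) = P A * P B

/-- Five outcomes, indexed cyclically, in which exactly the neighbouring ones are exclusive. -/
def IsWrightPentagon {Ξ : Type*} (S : PartitionScenario Ξ) (A : ZMod 5 → Set Ξ) : Prop :=
  (∀ i, A i ∈ S.fineOutcomes) ∧
    ∀ i j, S.Exclusive (A i) (A j) ↔ (j = i + 1 ∨ i = j + 1)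

end PartitionScenario

/-- `Branching J o C M`: after the boxes in `o` have been opened, with outcomes that single out the
set `C` of assignments, a sequential procedure remains that opens further boxes one at a time, the
choice of the next box being a function of the earlier outcomes, until the set of opened boxes is
a member of `J`; the partition of `C` into its final outcomes is `M`. -/
inductive Branching {X : Type*} (J : Set (Set X)) :
    Set X → Set (X → Bool) → Set (Set (X → Bool)) → Prop
  | leaf (o : Set X) (C : Set (X → Bool)) (ho : o ∈ J) : Branching J o C {C}
  | node (o : Set X) (C : Set (X → Bool)) (i : X) (hi : i ∉ o)
      (M : Bool → Set (Set (X → Bool)))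
      (hM : ∀ b, Branching J (insert i o) (C ∩ {γ | γ i = b}) (M b)) :
      Branching J o C (M false ∪ M true)

theorem Branching.partition_aux {X : Type*} {J : Set (Set X)} {o : Set X} {C : Set (X → Bool)}
    {M : Set (Set (X → Bool))} (h : Branching J o C M) :
    (∃ s : X → Bool, C = {γ | ∀ i ∈ o, γ i = s i}) →
      ∅ ∉ M ∧ (∀ A ∈ M, A ⊆ C) ∧ ∀ γ ∈ C, ∃! A, A ∈ M ∧ γ ∈ A := by
  classical
  induction h with
  | leaf o C ho =>
    rintro ⟨s, rfl⟩
    refine ⟨fun h => ?_, fun A hA => ?_, fun γ hγ => ⟨_, ⟨rfl, hγ⟩, fun A hA => hA.1⟩⟩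
    · have hs : s ∈ (∅ : Set (X → Bool)) := by
        rw [Set.mem_singleton_iff.1 h]
        exact fun i _ => rfl
      exact hs
    · rw [Set.mem_singleton_iff.1 hA]
  | node o C i hi M hM ih =>
    rintro ⟨s, rfl⟩
    have key : ∀ b, ∃ t : X → Bool,
        {γ : X → Bool | ∀ k ∈ o, γ k = s k} ∩ {γ | γ i = b} =
          {γ | ∀ k ∈ insert i o, γ k = t k} := by
      intro b
      refine ⟨Function.update s i b, ?_⟩
      ext γ
      simp only [Set.mem_inter_iff, Set.mem_ofPred_eq, Set.mem_insert_iff, forall_eq_or_imp,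
        Function.update_self]
      rw [and_comm]
      refine and_congr Iff.rfl (forall₂_congr fun k hk => ?_)
      rw [Function.update_of_ne (ne_of_mem_of_not_mem hk hi)]
    have main := fun b => ih b (key b)
    have hmem : ∀ A, A ∈ M false ∪ M true ↔ ∃ b, A ∈ M b := by
      intro A
      simp
    refine ⟨fun h => ?_, fun A hA => ?_, fun γ hγ => ?_⟩
    · obtain ⟨b, hb⟩ := (hmem _).1 h
      exact (main b).1 hb
    · obtain ⟨b, hb⟩ := (hmem _).1 hA
      exact ((main b).2.1 A hb).trans Set.inter_subset_left
    · obtain ⟨A, ⟨hA, hγA⟩, hu⟩ := (main (γ i)).2.2 γ ⟨hγ, rfl⟩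
      refine ⟨A, ⟨(hmem A).2 ⟨_, hA⟩, hγA⟩, ?_⟩
      rintro B ⟨hB, hγB⟩
      obtain ⟨b, hb⟩ := (hmem B).1 hB
      have hib : γ i = b := ((main b).2.1 B hb hγB).2
      subst hib
      exact hu B ⟨hb, hγB⟩

/-- The marginal scenario with boxes `X`, in which the sets of boxes in `J` can be jointly opened,
each box being found empty (`false`) or full (`true`). The sample space consists of all
assignments; the measurements are the branching ones, among them the opening of a fixed (finite)
member of `J`. -/
def marginalScenario {X : Type*} (J : Set (Set X)) : PartitionScenario (X → Bool) where
  measurements := {M | Branching J ∅ Set.univ M}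
  isPartition := by
    intro M hM
    obtain ⟨h1, -, h2⟩ := Branching.partition_aux hM ⟨fun _ => false, by simp⟩
    exact ⟨h1, fun γ => h2 γ (Set.mem_univ γ)⟩

/-- The Bell scenario with `n` parties, two inputs and two outputs per party: box `(i, x)` is opened
when party `i` has input `x`, and exactly one of the boxes of each party is opened. -/
def bellScenario (n : ℕ) : PartitionScenario (Fin n × Bool → Bool) :=
  marginalScenario {o : Set (Fin n × Bool) | ∀ i, ∃! x, (i, x) ∈ o}

/-- The outcome "outputs `a` on inputs `x`" of the Bell scenario. -/
def bellEvent {n : ℕ} (x a : Fin n → Bool) : Set (Fin n × Bool → Bool) :=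
  {γ | ∀ i, γ (i, x i) = a i}

/-- The correlator of the two outputs (as `±1`-valued quantities) on inputs `x`, `y`. -/
def correlator (P : Set (Fin 2 × Bool → Bool) → ℝ) (x y : Bool) : ℝ :=
  ∑ a : Bool, ∑ b : Bool, (if a = b then 1 else -1) * P (bellEvent ![x, y] ![a, b])

/-- The CHSH expression with the minus sign at the inputs `x₀`, `y₀`. -/
def chsh (P : Set (Fin 2 × Bool → Bool) → ℝ) (x₀ y₀ : Bool) : ℝ :=
  ∑ x : Bool, ∑ y : Bool, (if x = x₀ ∧ y = y₀ then -1 else 1) * correlator P x y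

/-- The winning probability in Guess Your Neighbour's Input with input distribution `q`: each
party has to output the input of the next party in cyclic order. -/
def gyniWin {n : ℕ} (q : (Fin n → Bool) → ℝ) (P : Set (Fin n × Bool → Bool) → ℝ) : ℝ :=
  ∑ x : Fin n → Bool, q x * P (bellEvent x fun i => x (finRotate n i))

/-!
The three bounds rest on consistent exclusivity (`AdmitsJointQuantumMeasure.sum_le_one`): if a
probability function has a joint quantum measure `μ`, then the probabilities of pairwise exclusive
outcomes sum to at most one. The Sorkin sum rule says that the interference term
`μ (A ∪ B) - μ A - μ B` is additive in each argument on disjoint sets. It vanishes for two disjoint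
outcomes of one measurement, hence between any two of the given outcomes and between each of them
and the rest of the sample space, so the total measure `1` is the sum of their probabilities and of
the non-negative measure of the rest.

In two independent copies, pairs of outcomes are exclusive as soon as one of their components are,
so that `∑ i, P (A i) * P (B i) ≤ 1` for such families of pairs
(`IsTwoIndependentCopies.sum_mul_le_one`). For a Wright pentagon the pairs `(A i, A (2 * i + k))`
form such a family for every shift `k`, and summing over `k` gives `(∑ i, P (A i)) ^ 2 ≤ 5`.

For CHSH, ten pairs of events are pairwise exclusive; in 5, 2 and 3 of them, respectively, both, one
or none of the components satisfy `a ⊕ b = x ∧ y`. Let `S` be any of the signed CHSH expressions.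
Eight relabellings of each copy turn this relation into the one that maximizes `S`. Averaging over
them replaces the probability of an event by `(4 ± S) / 16` (`ChshLabel.sum_relabel`), where the
sign tells whether the event satisfies the relation, and the inequality becomes
`5 * (4 + S) ^ 2 + 2 * (4 + S) * (4 - S) + 3 * (4 - S) ^ 2 ≤ 256`, or `(3 * S / 4 + 1) ^ 2 ≤ 10`.

In Guess Your Neighbour's Input, the winning events for inputs `x` and `y` are exclusive unless `y`
is `x` or its complement: otherwise some agreement of `x` and `y` is followed in the cyclic order by
a disagreement. By consistent exclusivity, applied to the more likely event of each complementary
pair, the winning probability is at most the maximum of `q x + q y` over complementary `x` and `y`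
(`gyniWin_le`), and a deterministic strategy attains this maximum.
-/

open PartitionScenario

/-! ### The Sorkin sum rule and exclusive outcomes -/

theorem sUnion_eq_univ_of_isPartition {Ξ : Type*} {M : Set (Set Ξ)} (hM : Setoid.IsPartition M) :
    ⋃₀ M = Set.univ := by
  refine Set.eq_univ_of_forall fun γ => ?_
  obtain ⟨A, ⟨hA, hγ⟩, -⟩ := hM.2 γ
  exact ⟨A, hA, hγ⟩

theorem mem_coarseAlgebra_of_mem {Ξ : Type*} {M : Set (Set Ξ)} {A : Set Ξ} (hA : A ∈ M) :
    A ∈ coarseAlgebra M :=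
  ⟨{A}, by simpa using hA, by simp⟩

theorem empty_mem_coarseAlgebra {Ξ : Type*} (M : Set (Set Ξ)) : ∅ ∈ coarseAlgebra M :=
  ⟨∅, by simp, by simp⟩

theorem union_mem_coarseAlgebra {Ξ : Type*} {M : Set (Set Ξ)} {A B : Set Ξ}
    (hA : A ∈ coarseAlgebra M) (hB : B ∈ coarseAlgebra M) : A ∪ B ∈ coarseAlgebra M := by
  obtain ⟨T, hT, rfl⟩ := hA
  obtain ⟨U, hU, rfl⟩ := hB
  exact ⟨T ∪ U, Set.union_subset hT hU, Set.sUnion_union T U |>.symm⟩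

theorem compl_mem_coarseAlgebra {Ξ : Type*} {M : Set (Set Ξ)} (hM : Setoid.IsPartition M)
    {A : Set Ξ} (hA : A ∈ M) : Aᶜ ∈ coarseAlgebra M := by
  refine ⟨M \ {A}, Set.sdiff_subset, ?_⟩
  ext γ
  simp only [Set.mem_compl_iff, Set.mem_sUnion, Set.mem_sdiff, Set.mem_singleton_iff]
  constructor
  · intro hγ
    obtain ⟨B, ⟨hB, hγB⟩, -⟩ := hM.2 γ
    exact ⟨B, ⟨hB, fun h => hγ (h ▸ hγB)⟩, hγB⟩
  · rintro ⟨B, ⟨hB, hne⟩, hγB⟩ hγA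
    exact hne ((hM.2 γ).unique ⟨hB, hγB⟩ ⟨hA, hγA⟩)

namespace PartitionScenario

variable {Ξ : Type*} {S : PartitionScenario Ξ} {P μ : Set Ξ → ℝ}

theorem IsProbabilityFunction.empty (hP : S.IsProbabilityFunction P) {M : Set (Set Ξ)}
    (hM : M ∈ S.measurements) : P ∅ = 0 := by
  have h := hP.additive M hM (fun _ => ∅) (fun _ => empty_mem_coarseAlgebra M)
    fun _ _ _ => disjoint_bot_left
  exact tendsto_nhds_unique tendsto_const_nhds h.summable.tendsto_atTop_zero

theorem IsProbabilityFunction.union (hP : S.IsProbabilityFunction P) {M : Set (Set Ξ)}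
    (hM : M ∈ S.measurements) {A B : Set Ξ} (hA : A ∈ coarseAlgebra M)
    (hB : B ∈ coarseAlgebra M) (hAB : Disjoint A B) : P (A ∪ B) = P A + P B := by
  let f : ℕ → Set Ξ := fun n => if n = 0 then A else if n = 1 then B else ∅
  have hf : ∀ n, 1 < n → f n = ∅ := fun n hn => by
    simp [f, show n ≠ 0 by omega, show n ≠ 1 by omega]
  have h := hP.additive M hM f
    (fun n => by dsimp only [f]; split_ifs <;> [exact hA; exact hB; exact empty_mem_coarseAlgebra M])
    (fun m n hmn => by
      dsimp only [f]
      split_ifs <;> first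
        | omega
        | exact hAB
        | exact hAB.symm
        | exact Set.disjoint_empty _
        | exact Set.empty_disjoint _)
  have hU : ⋃ n, f n = A ∪ B := by
    ext γ
    simp only [Set.mem_iUnion, Set.mem_union]
    constructor
    · rintro ⟨n, hn⟩
      dsimp only [f] at hn
      split_ifs at hn
      exacts [Or.inl hn, Or.inr hn, hn.elim]
    · rintro (h | h)
      exacts [⟨0, by simpa [f] using h⟩, ⟨1, by simpa [f] using h⟩]
  rw [hU] at h
  have h2 : HasSum (fun n => P (f n)) (∑ n ∈ Finset.range 2, P (f n)) := by
    refine hasSum_sum_of_ne_finset_zero fun n hn => ?_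
    rw [hf n (by simpa using hn), hP.empty hM]
  rw [h.unique h2]
  simp [Finset.sum_range_succ, f]

theorem IsProbabilityFunction.biUnion (hP : S.IsProbabilityFunction P) {M : Set (Set Ξ)}
    (hM : M ∈ S.measurements) {ι : Type*} {A : ι → Set Ξ} (s : Finset ι)
    (hA : ∀ i ∈ s, A i ∈ M) (hd : ∀ i ∈ s, ∀ j ∈ s, i ≠ j → Disjoint (A i) (A j)) :
    (⋃ i ∈ s, A i) ∈ coarseAlgebra M ∧ P (⋃ i ∈ s, A i) = ∑ i ∈ s, P (A i) := by
  classical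
  induction s using Finset.induction_on with
  | empty => simpa using ⟨empty_mem_coarseAlgebra M, hP.empty hM⟩
  | insert i s hi ih =>
    obtain ⟨h1, h2⟩ := ih (fun j hj => hA j (Finset.mem_insert_of_mem hj))
      fun j hj k hk => hd j (Finset.mem_insert_of_mem hj) k (Finset.mem_insert_of_mem hk)
    have hAi := mem_coarseAlgebra_of_mem (hA i (Finset.mem_insert_self i s))
    rw [Finset.set_biUnion_insert, Finset.sum_insert hi, ← h2]
    refine ⟨union_mem_coarseAlgebra hAi h1, hP.union hM hAi h1 ?_⟩
    rw [Set.disjoint_iUnion₂_right]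
    exact fun j hj => hd i (Finset.mem_insert_self i s) j (Finset.mem_insert_of_mem hj)
      fun h => hi (h ▸ hj)

/-- The interference term of two disjoint events, twice the real part of the decoherence
functional. -/
def interference (μ : Set Ξ → ℝ) (A B : Set Ξ) : ℝ :=
  μ (A ∪ B) - μ A - μ B

theorem interference_comm (μ : Set Ξ → ℝ) (A B : Set Ξ) :
    interference μ A B = interference μ B A := by
  unfold interference
  rw [Set.union_comm]
  ring

namespace IsJointQuantumMeasure

theorem empty (hμ : S.IsJointQuantumMeasure P μ) : μ ∅ = 0 := by
  have h := hμ.sorkin ∅ ∅ ∅ (Set.disjoint_empty _) (Set.disjoint_empty _) (Set.disjoint_empty _)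
  simp only [Set.union_self] at h
  linarith

theorem interference_union (hμ : S.IsJointQuantumMeasure P μ) {A B C : Set Ξ}
    (hAB : Disjoint A B) (hBC : Disjoint B C) (hCA : Disjoint C A) :
    interference μ A (B ∪ C) = interference μ A B + interference μ A C := by
  have h := hμ.sorkin A B C hAB hBC hCA
  unfold interference
  rw [← Set.union_assoc, Set.union_comm A C]
  linarith

theorem interference_biUnion_eq_zero (hμ : S.IsJointQuantumMeasure P μ) {ι : Type*} (B : Set Ξ)
    {A : ι → Set Ξ} (s : Finset ι) (hB : ∀ i ∈ s, Disjoint B (A i))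
    (hd : ∀ i ∈ s, ∀ j ∈ s, i ≠ j → Disjoint (A i) (A j))
    (h0 : ∀ i ∈ s, interference μ B (A i) = 0) : interference μ B (⋃ i ∈ s, A i) = 0 := by
  classical
  induction s using Finset.induction_on with
  | empty => simp [interference, hμ.empty]
  | insert i s hi ih =>
    have hs := fun j => Finset.mem_insert_of_mem (a := j) (b := i) (s := s)
    rw [Finset.set_biUnion_insert, hμ.interference_union, h0 i (Finset.mem_insert_self i s),
      ih (fun j hj => hB j (hs j hj)) (fun j hj k hk => hd j (hs j hj) k (hs k hk))
        fun j hj => h0 j (hs j hj), add_zero]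
    · exact hB i (Finset.mem_insert_self i s)
    · rw [Set.disjoint_iUnion₂_right]
      exact fun j hj => hd i (Finset.mem_insert_self i s) j (hs j hj) fun h => hi (h ▸ hj)
    · rw [Set.disjoint_iUnion₂_left]
      exact fun j hj => (hB j (hs j hj)).symm

theorem measure_biUnion (hμ : S.IsJointQuantumMeasure P μ) {ι : Type*} {A : ι → Set Ξ}
    (s : Finset ι) (hd : ∀ i ∈ s, ∀ j ∈ s, i ≠ j → Disjoint (A i) (A j))
    (h0 : ∀ i ∈ s, ∀ j ∈ s, i ≠ j → interference μ (A i) (A j) = 0) :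
    μ (⋃ i ∈ s, A i) = ∑ i ∈ s, μ (A i) := by
  classical
  induction s using Finset.induction_on with
  | empty => simp [hμ.empty]
  | insert i s hi ih =>
    have hs := fun j => Finset.mem_insert_of_mem (a := j) (b := i) (s := s)
    have hi' := Finset.mem_insert_self i s
    have hne : ∀ j ∈ s, i ≠ j := fun j hj h => hi (h ▸ hj)
    have h := hμ.interference_biUnion_eq_zero (A i) s (fun j hj => hd i hi' j (hs j hj) (hne j hj))
      (fun j hj k hk => hd j (hs j hj) k (hs k hk))
      fun j hj => h0 i hi' j (hs j hj) (hne j hj)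
    rw [Finset.set_biUnion_insert, Finset.sum_insert hi,
      ← ih (fun j hj k hk => hd j (hs j hj) k (hs k hk))
        fun j hj k hk => h0 j (hs j hj) k (hs k hk)]
    unfold interference at h
    linarith

theorem interference_eq_zero (hμ : S.IsJointQuantumMeasure P μ) (hP : S.IsProbabilityFunction P)
    {M : Set (Set Ξ)} (hM : M ∈ S.measurements) {A B : Set Ξ} (hA : A ∈ coarseAlgebra M)
    (hB : B ∈ coarseAlgebra M) (hAB : Disjoint A B) : interference μ A B = 0 := by
  unfold interference
  rw [hμ.agrees _ ⟨M, hM, union_mem_coarseAlgebra hA hB⟩, hμ.agrees _ ⟨M, hM, hA⟩,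
    hμ.agrees _ ⟨M, hM, hB⟩, hP.union hM hA hB hAB]
  ring

end IsJointQuantumMeasure

/-- Consistent exclusivity: a joint quantum measure forces the probabilities of pairwise exclusive
outcomes to sum to at most one, although the outcomes need not belong to one measurement. -/
theorem AdmitsJointQuantumMeasure.sum_le_one (hQ : S.AdmitsJointQuantumMeasure P)
    (hP : S.IsProbabilityFunction P) {ι : Type*} (s : Finset ι) (A : ι → Set Ξ)
    (hA : ∀ i ∈ s, A i ∈ S.fineOutcomes)
    (hex : ∀ i ∈ s, ∀ j ∈ s, i ≠ j → S.Exclusive (A i) (A j)) : ∑ i ∈ s, P (A i) ≤ 1 := by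
  classical
  obtain ⟨μ, hμ⟩ := hQ
  rcases s.eq_empty_or_nonempty with rfl | ⟨i₀, hi₀⟩
  · simp
  have hd : ∀ i ∈ s, ∀ j ∈ s, i ≠ j → Disjoint (A i) (A j) := fun i hi j hj h =>
    (hex i hi j hj h).1
  have h0 : ∀ i ∈ s, ∀ j ∈ s, i ≠ j → interference μ (A i) (A j) = 0 := by
    intro i hi j hj h
    obtain ⟨hdis, M, hM, hAi, hAj⟩ := hex i hi j hj h
    exact hμ.interference_eq_zero hP hM (mem_coarseAlgebra_of_mem hAi)
      (mem_coarseAlgebra_of_mem hAj) hdis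
  set R : Set Ξ := (⋃ i ∈ s, A i)ᶜ with hR
  have hRd : ∀ i ∈ s, Disjoint R (A i) := fun i hi =>
    disjoint_compl_left.mono_right (Set.subset_biUnion_of_mem (u := A) (Finset.mem_coe.2 hi))
  -- The complement of `A i` is an outcome, so `A i` has no interference with it; removing the
  -- other `A j` from the complement leaves `R`.
  have hRi : ∀ i ∈ s, interference μ R (A i) = 0 := by
    intro i hi
    obtain ⟨M, hM, hAi⟩ := hA i hi
    have h1 := hμ.interference_eq_zero hP hM (mem_coarseAlgebra_of_mem hAi)
      (compl_mem_coarseAlgebra (S.isPartition M hM) hAi) disjoint_compl_right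
    have hsub : ∀ j ∈ s.erase i, j ∈ s := fun j hj => Finset.mem_of_mem_erase hj
    have hdi : Disjoint (A i) (⋃ j ∈ s.erase i, A j) := by
      rw [Set.disjoint_iUnion₂_right]
      exact fun j hj => hd i hi j (hsub j hj) (Finset.ne_of_mem_erase hj).symm
    have hdR : Disjoint (⋃ j ∈ s.erase i, A j) R := by
      rw [Set.disjoint_iUnion₂_left]
      exact fun j hj => (hRd j (hsub j hj)).symm
    have hc : (A i)ᶜ = (⋃ j ∈ s.erase i, A j) ∪ R := by
      have hU : ⋃ j ∈ s, A j = A i ∪ ⋃ j ∈ s.erase i, A j := by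
        rw [← Finset.set_biUnion_insert, Finset.insert_erase hi]
      rw [hR, hU]
      ext γ
      have : γ ∈ A i → γ ∉ ⋃ j ∈ s.erase i, A j := fun h => Set.disjoint_left.1 hdi h
      simp only [Set.mem_compl_iff, Set.mem_union]
      tauto
    rw [hc, hμ.interference_union hdi hdR (hRd i hi),
      hμ.interference_biUnion_eq_zero (A i) (s.erase i)
        (fun j hj => hd i hi j (hsub j hj) (Finset.ne_of_mem_erase hj).symm)
        (fun j hj k hk => hd j (hsub j hj) k (hsub k hk))
        (fun j hj => h0 i hi j (hsub j hj) (Finset.ne_of_mem_erase hj).symm), zero_add] at h1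
    rw [interference_comm, h1]
  have h2 := hμ.interference_biUnion_eq_zero R s hRd hd hRi
  have h3 := hμ.measure_biUnion s hd h0
  obtain ⟨M, hM, -⟩ := hA i₀ hi₀
  have h4 : μ Set.univ = 1 := by
    rw [← sUnion_eq_univ_of_isPartition (S.isPartition M hM), ← hP.total M hM]
    exact hμ.agrees _ ⟨M, hM, M, subset_rfl, rfl⟩
  have h5 : ∑ i ∈ s, P (A i) = ∑ i ∈ s, μ (A i) := by
    refine Finset.sum_congr rfl fun i hi => ?_
    obtain ⟨M, hM, hAi⟩ := hA i hi
    exact (hμ.agrees _ ⟨M, hM, mem_coarseAlgebra_of_mem hAi⟩).symm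
  rw [interference, hR, Set.compl_union_self, h4, h3] at h2
  have h6 := hμ.nonneg R
  rw [hR] at h6
  linarith

/-! ### Two independent copies -/

theorem ne_empty_of_mem_fineOutcomes {A : Set Ξ} (hA : A ∈ S.fineOutcomes) : A ≠ ∅ := by
  rintro rfl
  obtain ⟨M, hM, h⟩ := hA
  exact (S.isPartition M hM).1 h

theorem prod_mem_fineOutcomes {A B : Set Ξ} (hA : A ∈ S.fineOutcomes) (hB : B ∈ S.fineOutcomes) :
    A ×ˢ B ∈ (S.prod S).fineOutcomes := by
  obtain ⟨M, hM, hA⟩ := hA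
  obtain ⟨N, hN, hB⟩ := hB
  exact ⟨branchFirst M fun _ => N, Or.inl ⟨M, hM, _, fun _ _ => hN, rfl⟩, A, hA, B, hB, rfl⟩

/-- If the first components are exclusive, the measurement on the second copy can be adapted to
the outcome on the first one. -/
theorem Exclusive.prod_left {A A' B B' : Set Ξ} (h : S.Exclusive A A')
    (hB : B ∈ S.fineOutcomes) (hB' : B' ∈ S.fineOutcomes) :
    (S.prod S).Exclusive (A ×ˢ B) (A' ×ˢ B') := by
  classical
  obtain ⟨hd, M, hM, hA, hA'⟩ := h
  obtain ⟨N, hN, hB⟩ := hB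
  obtain ⟨N', hN', hB'⟩ := hB'
  have hne : A' ≠ A := by
    rintro rfl
    exact ne_empty_of_mem_fineOutcomes ⟨M, hM, hA⟩ (disjoint_self.1 hd)
  refine ⟨Set.disjoint_prod.2 (Or.inl hd), branchFirst M fun C => if C = A then N else N',
    Or.inl ⟨M, hM, _, fun C _ => ?_, rfl⟩, ⟨A, hA, B, ?_, rfl⟩, ⟨A', hA', B', ?_, rfl⟩⟩
  · split_ifs <;> assumption
  · simpa using hB
  · simpa [hne] using hB'

theorem Exclusive.prod_right {A A' B B' : Set Ξ} (h : S.Exclusive B B')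
    (hA : A ∈ S.fineOutcomes) (hA' : A' ∈ S.fineOutcomes) :
    (S.prod S).Exclusive (A ×ˢ B) (A' ×ˢ B') := by
  classical
  obtain ⟨hd, M, hM, hB, hB'⟩ := h
  obtain ⟨N, hN, hA⟩ := hA
  obtain ⟨N', hN', hA'⟩ := hA'
  have hne : B' ≠ B := by
    rintro rfl
    exact ne_empty_of_mem_fineOutcomes ⟨M, hM, hB⟩ (disjoint_self.1 hd)
  refine ⟨Set.disjoint_prod.2 (Or.inr hd), branchSecond M fun C => if C = B then N else N',
    Or.inr ⟨M, hM, _, fun C _ => ?_, rfl⟩, ⟨B, hB, A, ?_, rfl⟩, ⟨B', hB', A', ?_, rfl⟩⟩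
  · split_ifs <;> assumption
  · simpa using hA
  · simpa [hne] using hA'

/-- Consistent exclusivity for two independent copies: two pairs of outcomes exclude each other as
soon as one of their components do. -/
theorem IsTwoIndependentCopies.sum_mul_le_one {P₂ : Set (Ξ × Ξ) → ℝ}
    (hP : S.IsTwoIndependentCopies P P₂) (hQ : (S.prod S).AdmitsJointQuantumMeasure P₂)
    {ι : Type*} [Fintype ι] (A B : ι → Set Ξ) (hA : ∀ i, A i ∈ S.fineOutcomes)
    (hB : ∀ i, B i ∈ S.fineOutcomes)
    (hex : ∀ i j, i ≠ j → S.Exclusive (A i) (A j) ∨ S.Exclusive (B i) (B j)) :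
    ∑ i, P (A i) * P (B i) ≤ 1 := by
  have h := hQ.sum_le_one hP.joint Finset.univ (fun i => A i ×ˢ B i)
    (fun i _ => prod_mem_fineOutcomes (hA i) (hB i)) fun i _ j _ hij =>
      (hex i j hij).elim (fun h => h.prod_left (hB i) (hB j)) fun h => h.prod_right (hA i) (hA j)
  simpa only [hP.indep _ (hA _) _ (hB _)] using h

/-! ### The Wright pentagon -/

/-- Doubling the index turns non-neighbours of the pentagon into neighbours, so that for each shift
`k` the five pairs `(A i, A (2 * i + k))` are pairwise exclusive in two copies. -/
theorem IsWrightPentagon.sum_le_sqrt_five {A : ZMod 5 → Set Ξ} (hW : S.IsWrightPentagon A)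
    {P₂ : Set (Ξ × Ξ) → ℝ} (hP : S.IsTwoIndependentCopies P P₂)
    (hQ : (S.prod S).AdmitsJointQuantumMeasure P₂) : ∑ i, P (A i) ≤ Real.sqrt 5 := by
  obtain ⟨hA, hex⟩ := hW
  have key : ∀ i j k : ZMod 5, i ≠ j → (j = i + 1 ∨ i = j + 1) ∨
      (2 * j + k = 2 * i + k + 1 ∨ 2 * i + k = 2 * j + k + 1) := by decide
  have h1 : ∀ k : ZMod 5, ∑ i, P (A i) * P (A (2 * i + k)) ≤ 1 := fun k =>
    hP.sum_mul_le_one hQ A (fun i => A (2 * i + k)) hA (fun i => hA _) fun i j hij => by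
      rw [hex, hex]
      exact key i j k hij
  have h2 : (∑ i, P (A i)) ^ 2 ≤ 5 := by
    calc (∑ i, P (A i)) ^ 2 = ∑ i, P (A i) * ∑ k : ZMod 5, P (A (2 * i + k)) := by
          rw [sq, Finset.sum_mul]
          exact Finset.sum_congr rfl fun i _ =>
            congrArg _ (Equiv.sum_comp (Equiv.addLeft (2 * i)) fun k => P (A k)).symm
      _ = ∑ k : ZMod 5, ∑ i, P (A i) * P (A (2 * i + k)) := by
          simp only [Finset.mul_sum]
          exact Finset.sum_comm
      _ ≤ ∑ _k : ZMod 5, (1 : ℝ) := Finset.sum_le_sum fun k _ => h1 k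
      _ = 5 := by simp [ZMod.card]
  exact Real.le_sqrt_of_sq_le h2

end PartitionScenario

/-! ### Measurements of the Bell scenario -/

theorem setOf_inter_bellEvent {n : ℕ} (x a : Fin n → Bool) (i : Fin n) :
    {γ | γ (i, x i) = a i} ∩ bellEvent x a = bellEvent x a :=
  Set.inter_eq_right.2 fun _ hγ => hγ i

/-- After the parties outside `s` have received their inputs from `x`, with results that single out
`C`, the other parties can receive theirs one after another. The events that `x` then distinguishes
within `C` are final outcomes. -/
theorem exists_branching_inter_bellEvent {n : ℕ} (x : Fin n → Bool) (s : Finset (Fin n))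
    (C : Set (Fin n × Bool → Bool)) :
    ∃ M, Branching {o : Set (Fin n × Bool) | ∀ i, ∃! x, (i, x) ∈ o}
      {k | k.1 ∉ s ∧ k.2 = x k.1} C M ∧
      ∀ a, (∀ i ∉ s, ∀ γ ∈ C, γ (i, x i) = a i) → C ∩ bellEvent x a ∈ M := by
  classical
  induction s using Finset.induction_on generalizing C with
  | empty =>
    refine ⟨{C}, Branching.leaf _ _ fun i => ⟨x i, by simp, by simp⟩, fun a ha => ?_⟩
    rw [Set.mem_singleton_iff, Set.inter_eq_left]
    exact fun γ hγ i => ha i (Finset.notMem_empty i) γ hγ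
  | insert i s hi ih =>
    choose M hM hmem using ih
    refine ⟨_, Branching.node _ C (i, x i) (by simp)
      (fun b => M (C ∩ {γ | γ (i, x i) = b})) fun b => ?_, fun a ha => ?_⟩
    · convert hM (C ∩ {γ | γ (i, x i) = b}) using 1
      ext ⟨j, y⟩
      by_cases hj : j = i
      · subst hj
        simp [hi]
      · simp [hj]
    · have h := hmem (C ∩ {γ | γ (i, x i) = a i}) a fun j hj γ hγ => by
        by_cases hji : j = i
        · subst hji
          exact hγ.2
        · exact ha j (by simp [hji, hj]) γ hγ.1
      have hC : C ∩ {γ | γ (i, x i) = a i} ∩ bellEvent x a = C ∩ bellEvent x a := by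
        rw [Set.inter_assoc, setOf_inter_bellEvent]
      rw [hC] at h
      cases hb : a i
      · rw [hb] at h
        exact Or.inl h
      · rw [hb] at h
        exact Or.inr h

/-- The measurement in which the inputs `x` are fixed in advance. -/
theorem exists_measurement_bellEvent {n : ℕ} (x : Fin n → Bool) :
    ∃ M ∈ (bellScenario n).measurements, ∀ a, bellEvent x a ∈ M := by
  obtain ⟨M, hM, h⟩ := exists_branching_inter_bellEvent x Finset.univ Set.univ
  refine ⟨M, ?_, fun a => ?_⟩
  · simpa [bellScenario, marginalScenario] using hM
  · simpa using h a (by simp)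

theorem bellEvent_mem_fineOutcomes {n : ℕ} (x a : Fin n → Bool) :
    bellEvent x a ∈ (bellScenario n).fineOutcomes := by
  obtain ⟨M, hM, h⟩ := exists_measurement_bellEvent x
  exact ⟨M, hM, h a⟩

/-- Locally orthogonal events are exclusive: the party with equal inputs and different outputs is
measured first, and its output determines the inputs of the others. -/
theorem exclusive_bellEvent {n : ℕ} {x y a b : Fin n → Bool} (i : Fin n) (hxy : x i = y i)
    (hab : a i ≠ b i) : (bellScenario n).Exclusive (bellEvent x a) (bellEvent y b) := by
  classical
  refine ⟨Set.disjoint_left.2 fun γ h1 h2 => hab ?_, ?_⟩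
  · rw [← h1 i, hxy, h2 i]
  have key : ∀ z c : Fin n → Bool, ∃ M, Branching
      {o : Set (Fin n × Bool) | ∀ i, ∃! x, (i, x) ∈ o} (insert (i, z i) ∅)
      (Set.univ ∩ {γ | γ (i, z i) = c i}) M ∧ bellEvent z c ∈ M := by
    intro z c
    obtain ⟨M, hM, h⟩ := exists_branching_inter_bellEvent z (Finset.univ.erase i)
      (Set.univ ∩ {γ | γ (i, z i) = c i})
    refine ⟨M, ?_, ?_⟩
    · convert hM using 1
      ext ⟨j, y⟩
      by_cases hj : j = i
      · subst hj
        simp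
      · simp [hj]
    · have h' := h c fun j hj γ hγ => by
        obtain rfl : j = i := by simpa using hj
        exact hγ.2
      rwa [Set.univ_inter, setOf_inter_bellEvent] at h'
  obtain ⟨M, hM, hMa⟩ := key x a
  obtain ⟨N, hN, hNb⟩ := key y b
  rw [← hxy] at hN
  have hnode := Branching.node (J := {o : Set (Fin n × Bool) | ∀ i, ∃! x, (i, x) ∈ o}) ∅ Set.univ
    (i, x i) (Set.notMem_empty _) (fun c => if c = a i then M else N) fun c => by
      by_cases hc : c = a i
      · subst hc
        simpa using hM
      · obtain rfl : c = b i := by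
          revert hc hab
          generalize a i = u
          generalize b i = v
          revert u v c
          decide
        simpa [hc] using hN
  refine ⟨_, hnode, ?_, ?_⟩
  · cases h : a i
    · exact Or.inl (by simpa [h] using hMa)
    · exact Or.inr (by simpa [h] using hMa)
  · cases h : b i
    · exact Or.inl (by simpa [h ▸ hab] using hNb)
    · exact Or.inr (by simpa [h ▸ hab] using hNb)

theorem sum_bellEvent {n : ℕ} {P : Set (Fin n × Bool → Bool) → ℝ}
    (hP : (bellScenario n).IsProbabilityFunction P) (x : Fin n → Bool) :
    ∑ a, P (bellEvent x a) = 1 := by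
  obtain ⟨M, hM, h⟩ := exists_measurement_bellEvent x
  rw [← (hP.biUnion hM Finset.univ (fun a _ => h a) fun a _ b _ hab => ?_).2, ← hP.total M hM,
    sUnion_eq_univ_of_isPartition ((bellScenario n).isPartition M hM)]
  · congr 1
    refine Set.eq_univ_of_forall fun γ => ?_
    simp only [Finset.mem_univ, Set.iUnion_true, Set.mem_iUnion]
    exact ⟨fun i => γ (i, x i), fun i => rfl⟩
  · refine Set.disjoint_left.2 fun γ h1 h2 => hab (funext fun i => ?_)
    rw [← h1 i, h2 i]

/-! ### Two copies of the CHSH scenario -/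

/-- The input and output of both parties in a CHSH experiment, in the order `x, y, a, b`. -/
abbrev ChshLabel : Type := Bool × Bool × Bool × Bool

namespace ChshLabel

/-- The event described by a label. -/
def event (e : ChshLabel) : Set (Fin 2 × Bool → Bool) :=
  bellEvent ![e.1, e.2.1] ![e.2.2.1, e.2.2.2]

/-- Local orthogonality: some party has the same input and different outputs. -/
def Orthogonal (e f : ChshLabel) : Prop :=
  (e.1 = f.1 ∧ e.2.2.1 ≠ f.2.2.1) ∨ (e.2.1 = f.2.1 ∧ e.2.2.2 ≠ f.2.2.2)

instance : DecidableRel Orthogonal := fun _ _ => inferInstanceAs (Decidable (_ ∨ _))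

theorem Orthogonal.exclusive {e f : ChshLabel} (h : Orthogonal e f) :
    (bellScenario 2).Exclusive e.event f.event :=
  h.elim (fun h => exclusive_bellEvent 0 h.1 h.2) fun h => exclusive_bellEvent 1 h.1 h.2

/-- A relabelling of inputs and outputs. Its parameter `c = (s, t, r)` shifts the inputs by `s` and
`t`, corrected by `x₀` and `y₀`, and flips the outputs in dependence on the local inputs, such that
the label satisfies `a ⊕ b = x ∧ y` if and only if its image satisfies
`a ⊕ b = (x = x₀ ∧ y = y₀) ⊕ v`. -/
def relabel (x₀ y₀ v : Bool) (c : Bool × Bool × Bool) (e : ChshLabel) : ChshLabel :=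
  (e.1 ^^ c.1 ^^ !x₀, e.2.1 ^^ c.2.1 ^^ !y₀, e.2.2.1 ^^ c.2.2 ^^ (c.2.1 && e.1) ^^ v,
    e.2.2.2 ^^ c.2.2 ^^ (c.1 && e.2.1) ^^ (c.1 && c.2.1))

theorem Orthogonal.relabel {e f : ChshLabel} (h : Orthogonal e f) (x₀ y₀ v : Bool)
    (c : Bool × Bool × Bool) : Orthogonal (e.relabel x₀ y₀ v c) (f.relabel x₀ y₀ v c) := by
  obtain ⟨x, y, a, b⟩ := e
  obtain ⟨x', y', a', b'⟩ := f
  rcases h with ⟨h1, h2⟩ | ⟨h1, h2⟩ <;> dsimp only at h1 h2 <;> subst h1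
  · exact Or.inl ⟨rfl, by simpa [ChshLabel.relabel] using h2⟩
  · exact Or.inr ⟨rfl, by simpa [ChshLabel.relabel] using h2⟩

/-- The first components of a clique of ten label pairs. The pairs number 5, 2 and 3 according to
whether both, one or none of the components satisfy `a ⊕ b = x ∧ y`. -/
def cliqueFst : Fin 10 → ChshLabel :=
  ![(true, false, false, false), (false, false, true, false), (false, true, false, false),
    (true, true, true, false), (false, true, true, true), (false, false, true, true),
    (false, false, true, true), (false, true, false, true), (true, true, true, true),
    (false, false, false, true)]

/-- The second components of the clique of `cliqueFst`. -/
def cliqueSnd : Fin 10 → ChshLabel :=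
  ![(false, false, true, true), (false, true, false, true), (true, false, false, false),
    (true, true, true, false), (false, true, false, false), (false, true, false, true),
    (false, true, true, true), (false, true, false, false), (false, true, true, false),
    (true, true, true, true)]

theorem orthogonal_clique : ∀ k l : Fin 10, k ≠ l →
    Orthogonal (cliqueFst k) (cliqueFst l) ∨ Orthogonal (cliqueSnd k) (cliqueSnd l) := by
  decide

theorem sum_event {P : Set (Fin 2 × Bool → Bool) → ℝ}
    (hP : (bellScenario 2).IsProbabilityFunction P) (x y : Bool) :
    P (event (x, y, true, true)) + P (event (x, y, true, false)) +
      P (event (x, y, false, true)) + P (event (x, y, false, false)) = 1 := by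
  have h := sum_bellEvent hP ![x, y]
  rw [← Equiv.sum_comp (finTwoArrowEquiv Bool).symm, Fintype.sum_prod_type] at h
  simp only [Fintype.sum_bool, finTwoArrowEquiv_symm_apply] at h
  simp only [event]
  linarith

theorem correlator_eq (P : Set (Fin 2 × Bool → Bool) → ℝ) (x y : Bool) :
    correlator P x y = P (event (x, y, true, true)) - P (event (x, y, true, false)) -
      P (event (x, y, false, true)) + P (event (x, y, false, false)) := by
  simp [correlator, event]
  ring

/-- Flipping both outputs keeps their correlation, so the two flipped events share the probability
that the correlator assigns to it. -/
theorem sum_flip {P : Set (Fin 2 × Bool → Bool) → ℝ}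
    (hP : (bellScenario 2).IsProbabilityFunction P) (x y a b a' b' : Bool) :
    ∑ r, P (event (x, y, a ^^ r ^^ a', b ^^ r ^^ b')) =
      (1 + (if (a ^^ a') = (b ^^ b') then 1 else -1) * correlator P x y) / 2 := by
  have h := sum_event hP x y
  rw [correlator_eq, Fintype.sum_bool]
  cases a <;> cases b <;> cases a' <;> cases b' <;> simp <;> linarith

/-- Averaged over the relabellings, the probability of an event depends only on whether its label
satisfies `a ⊕ b = x ∧ y`, and is affine in the CHSH expression. -/
theorem sum_relabel {P : Set (Fin 2 × Bool → Bool) → ℝ}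
    (hP : (bellScenario 2).IsProbabilityFunction P) (x₀ y₀ v : Bool) (e : ChshLabel) :
    ∑ c, P (e.relabel x₀ y₀ v c).event =
      2 + (if (e.2.2.1 ^^ e.2.2.2) = (e.1 && e.2.1) then 1 else -1) *
        ((if v then -1 else 1) * chsh P x₀ y₀) / 2 := by
  obtain ⟨x, y, a, b⟩ := e
  have h : ∀ s t : Bool, ∑ r, P (relabel x₀ y₀ v (s, t, r) (x, y, a, b)).event =
      (1 + (if (a ^^ ((t && x) ^^ v)) = (b ^^ ((s && y) ^^ (s && t))) then 1 else -1) *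
        correlator P (x ^^ s ^^ !x₀) (y ^^ t ^^ !y₀)) / 2 := fun s t => by
    rw [← sum_flip hP]
    simp only [relabel, Bool.xor_assoc]
  simp only [Fintype.sum_prod_type, h, chsh, Fintype.sum_bool]
  generalize correlator P = E
  cases x₀ <;> cases y₀ <;> cases v <;> cases x <;> cases y <;> cases a <;> cases b <;>
    simp <;> ring

/-- The clique inequality, averaged over independent relabellings of the two copies, is quadratic
in the CHSH expression. -/
theorem chsh_mul_sign_le {P : Set (Fin 2 × Bool → Bool) → ℝ}
    {P₂ : Set ((Fin 2 × Bool → Bool) × (Fin 2 × Bool → Bool)) → ℝ}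
    (hP : (bellScenario 2).IsTwoIndependentCopies P P₂)
    (hQ : ((bellScenario 2).prod (bellScenario 2)).AdmitsJointQuantumMeasure P₂)
    (x₀ y₀ v : Bool) :
    (if v then -1 else 1) * chsh P x₀ y₀ ≤ 4 * (Real.sqrt 10 - 1) / 3 := by
  have h1 : ∀ c d : Bool × Bool × Bool,
      ∑ k, P ((cliqueFst k).relabel x₀ y₀ v c).event * P ((cliqueSnd k).relabel x₀ y₀ v d).event
        ≤ 1 := fun c d =>
    hP.sum_mul_le_one hQ _ _ (fun k => bellEvent_mem_fineOutcomes _ _)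
      (fun k => bellEvent_mem_fineOutcomes _ _) fun k l hkl =>
        (orthogonal_clique k l hkl).imp (fun h => (h.relabel x₀ y₀ v c).exclusive)
          fun h => (h.relabel x₀ y₀ v d).exclusive
  have h2 : ∑ k, (∑ c, P ((cliqueFst k).relabel x₀ y₀ v c).event) *
      (∑ d, P ((cliqueSnd k).relabel x₀ y₀ v d).event) ≤ 64 := by
    calc _ = ∑ c, ∑ d, ∑ k, P ((cliqueFst k).relabel x₀ y₀ v c).event *
            P ((cliqueSnd k).relabel x₀ y₀ v d).event := by
          simp only [Finset.sum_mul_sum]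
          rw [Finset.sum_comm]
          exact Finset.sum_congr rfl fun c _ => Finset.sum_comm
      _ ≤ ∑ _c : Bool × Bool × Bool, ∑ _d : Bool × Bool × Bool, (1 : ℝ) :=
          Finset.sum_le_sum fun c _ => Finset.sum_le_sum fun d _ => h1 c d
      _ = 64 := by simp; norm_num
  simp only [sum_relabel hP.single] at h2
  generalize (if v then (-1 : ℝ) else 1) * chsh P x₀ y₀ = T at h2 ⊢
  simp [Fin.sum_univ_succ, cliqueFst, cliqueSnd] at h2
  have h3 : (3 * T / 4 + 1) ^ 2 ≤ 10 := by linarith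
  have h4 := Real.le_sqrt_of_sq_le h3
  linarith

end ChshLabel

theorem abs_chsh_le {P : Set (Fin 2 × Bool → Bool) → ℝ}
    {P₂ : Set ((Fin 2 × Bool → Bool) × (Fin 2 × Bool → Bool)) → ℝ}
    (hP : (bellScenario 2).IsTwoIndependentCopies P P₂)
    (hQ : ((bellScenario 2).prod (bellScenario 2)).AdmitsJointQuantumMeasure P₂)
    (x₀ y₀ : Bool) : |chsh P x₀ y₀| ≤ 4 * (Real.sqrt 10 - 1) / 3 := by
  have h1 := ChshLabel.chsh_mul_sign_le hP hQ x₀ y₀ false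
  have h2 := ChshLabel.chsh_mul_sign_le hP hQ x₀ y₀ true
  simp only [Bool.false_eq_true, if_false, if_true] at h1 h2
  exact abs_le.2 ⟨by linarith, by linarith⟩

/-! ### Guess Your Neighbour's Input -/

/-- The probability function of the deterministic assignment `γ`. -/
noncomputable def pointProbability {Ξ : Type*} (γ : Ξ) (C : Set Ξ) : ℝ :=
  C.indicator (fun _ => 1) γ

namespace PartitionScenario

theorem isProbabilityFunction_pointProbability {Ξ : Type*} (S : PartitionScenario Ξ) (γ : Ξ) :
    S.IsProbabilityFunction (pointProbability γ) where
  nonneg C _ := Set.indicator_nonneg (fun _ _ => zero_le_one) γ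
  total M hM := by
    rw [sUnion_eq_univ_of_isPartition (S.isPartition M hM)]
    simp [pointProbability]
  additive M hM f hf hd := by
    by_cases h : ∃ n, γ ∈ f n
    · obtain ⟨n, hn⟩ := h
      have h1 : pointProbability γ (⋃ n, f n) = pointProbability γ (f n) := by
        rw [pointProbability, pointProbability, Set.indicator_of_mem hn,
          Set.indicator_of_mem (Set.mem_iUnion.2 ⟨n, hn⟩)]
      rw [h1]
      exact hasSum_single n fun m hm =>
        Set.indicator_of_notMem (fun h => Set.disjoint_left.1 (hd hm) h hn) _
    · have h1 : ∀ n, pointProbability γ (f n) = 0 := fun n =>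
        Set.indicator_of_notMem (fun hn => h ⟨n, hn⟩) _
      have h2 : pointProbability γ (⋃ n, f n) = 0 :=
        Set.indicator_of_notMem (fun hn => h (Set.mem_iUnion.1 hn)) _
      simp only [h1, h2]
      exact hasSum_zero

theorem nonContextual_pointProbability {Ξ : Type*} (S : PartitionScenario Ξ) (γ : Ξ) :
    S.NonContextual (pointProbability γ) := by
  let _ : MeasurableSpace Ξ := ⊤
  refine ⟨⊤, MeasureTheory.Measure.dirac γ, inferInstance, fun C _ => ⟨trivial, ?_⟩⟩
  rw [MeasureTheory.measureReal_def, MeasureTheory.Measure.dirac_apply]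
  by_cases h : γ ∈ C <;> simp [pointProbability, h]

end PartitionScenario

/-- If two input strings agree somewhere, but no agreement is followed by a disagreement in the
cyclic order, then they agree everywhere. -/
theorem eq_of_forall_eq_imp_eq_finRotate {n : ℕ} {x y : Fin n → Bool}
    (h : ∀ i, x i = y i → x (finRotate n i) = y (finRotate n i)) {i : Fin n} (hi : x i = y i) :
    x = y := by
  obtain _ | n := n
  · exact i.elim0
  have key : ∀ k, x (i + k) = y (i + k) := by
    intro k
    induction k using Fin.induction with
    | zero => simpa using hi
    | succ k ih =>
      have := h _ ih
      rwa [finRotate_apply, add_assoc, Fin.coeSucc_eq_succ] at this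
  funext j
  simpa using key (j - i)

theorem exists_eq_and_finRotate_ne {n : ℕ} {x y : Fin n → Bool} (h1 : x ≠ y)
    (h2 : x ≠ fun i => !y i) : ∃ i, x i = y i ∧ x (finRotate n i) ≠ y (finRotate n i) := by
  by_contra! h
  by_cases hi : ∃ i, x i = y i
  · obtain ⟨i, hi⟩ := hi
    exact h1 (eq_of_forall_eq_imp_eq_finRotate h hi)
  · exact h2 (funext fun i => Bool.eq_not_of_ne fun h => hi ⟨i, h⟩)

/-- The complement of an input string. -/
def flipInputs (n : ℕ) : Equiv.Perm (Fin n → Bool) :=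
  Function.Involutive.toPerm (fun x i => !x i) fun x => by simp

@[simp]
theorem flipInputs_apply {n : ℕ} (x : Fin n → Bool) (i : Fin n) : flipInputs n x i = !x i :=
  rfl

theorem flipInputs_flipInputs {n : ℕ} (x : Fin n → Bool) : flipInputs n (flipInputs n x) = x :=
  (flipInputs n).left_inv x

/-- The event that the game is won on the inputs `x`. -/
def gyniEvent {n : ℕ} (x : Fin n → Bool) : Set (Fin n × Bool → Bool) :=
  bellEvent x fun i => x (finRotate n i)

theorem exclusive_gyniEvent {n : ℕ} {x y : Fin n → Bool} (h1 : x ≠ y) (h2 : x ≠ flipInputs n y) :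
    (bellScenario n).Exclusive (gyniEvent x) (gyniEvent y) := by
  obtain ⟨i, hi, hi'⟩ := exists_eq_and_finRotate_ne h1 h2
  exact exclusive_bellEvent i hi hi'

theorem gyniWin_le {n : ℕ} [NeZero n] {q : (Fin n → Bool) → ℝ} (hq : ∀ x, 0 ≤ q x)
    {P : Set (Fin n × Bool → Bool) → ℝ} (hP : (bellScenario n).IsProbabilityFunction P)
    (hQ : (bellScenario n).AdmitsJointQuantumMeasure P) {K : ℝ}
    (hK : ∀ x, q x + q (flipInputs n x) ≤ K) : gyniWin q P ≤ K := by
  classical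
  have hK0 : 0 ≤ K := (add_nonneg (hq _) (hq _)).trans (hK fun _ => false)
  set p : (Fin n → Bool) → ℝ := fun x => P (gyniEvent x) with hp
  -- `T` contains the more likely member of every pair `{x, flipInputs n x}`, ties being broken by
  -- the first bit.
  let T : (Fin n → Bool) → Prop := fun x =>
    p (flipInputs n x) < p x ∨ (p (flipInputs n x) = p x ∧ x 0 = true)
  have hT : ∀ x, T (flipInputs n x) ↔ ¬ T x := by
    intro x
    simp only [T, flipInputs_flipInputs, flipInputs_apply]
    rcases lt_trichotomy (p x) (p (flipInputs n x)) with h | h | h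
    · simp [h, h.not_gt, h.ne, h.ne']
    · simp [h]
    · simp [h, h.not_gt, h.ne, h.ne']
  have hTp : ∀ x, T x → p (flipInputs n x) ≤ p x := fun x h => h.elim le_of_lt fun h => h.1.le
  have hone : ∑ x with T x, p x ≤ 1 := by
    refine hQ.sum_le_one hP _ gyniEvent (fun x _ => bellEvent_mem_fineOutcomes _ _)
      fun x hx y hy hxy => exclusive_gyniEvent hxy ?_
    rintro rfl
    simp only [Finset.mem_filter, Finset.mem_univ, true_and] at hx hy
    exact (hT y).1 hx hy
  calc gyniWin q P = ∑ x, q x * p x := rfl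
    _ = ∑ x with T x, q x * p x + ∑ x with ¬ T x, q x * p x :=
        (Finset.sum_filter_add_sum_filter_not _ _ _).symm
    _ = ∑ x with T x, q x * p x + ∑ x with T x, q (flipInputs n x) * p (flipInputs n x) := by
        congr 1
        rw [Finset.sum_filter, Finset.sum_filter, ← Equiv.sum_comp (flipInputs n)]
        simp only [hT, not_not]
    _ = ∑ x with T x, (q x * p x + q (flipInputs n x) * p (flipInputs n x)) :=
        Finset.sum_add_distrib.symm
    _ ≤ ∑ x with T x, K * p x := by
        refine Finset.sum_le_sum fun x hx => ?_
        have h1 := hTp x (by simpa using hx)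
        have h2 : 0 ≤ p x := by
          obtain ⟨M, hM, h⟩ := bellEvent_mem_fineOutcomes x fun i => x (finRotate n i)
          exact hP.nonneg _ ⟨M, hM, mem_coarseAlgebra_of_mem h⟩
        have h3 := mul_le_mul_of_nonneg_left h1 (hq (flipInputs n x))
        have h4 := mul_le_mul_of_nonneg_right (hK x) h2
        linarith
    _ = K * ∑ x with T x, p x := by rw [Finset.mul_sum]
    _ ≤ K := mul_le_of_le_one_right hK0 hone

/-- Deterministic answers that win the game both on the inputs `x` and on the complementary inputs. -/
def gyniStrategy {n : ℕ} (x : Fin n → Bool) : Fin n × Bool → Bool :=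
  fun k => x (finRotate n k.1) ^^ (k.2 ^^ x k.1)

theorem le_gyniWin_gyniStrategy {n : ℕ} [NeZero n] {q : (Fin n → Bool) → ℝ} (hq : ∀ x, 0 ≤ q x)
    (x : Fin n → Bool) :
    q x + q (flipInputs n x) ≤ gyniWin q (pointProbability (gyniStrategy x)) := by
  classical
  have hne : x ≠ flipInputs n x := fun h => by simpa using congrFun h 0
  have h1 : gyniStrategy x ∈ gyniEvent x := fun i => by simp [gyniStrategy]
  have h2 : gyniStrategy x ∈ gyniEvent (flipInputs n x) := fun i => by
    simp [gyniStrategy]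
  calc q x + q (flipInputs n x)
      = ∑ y ∈ {x, flipInputs n x}, q y * pointProbability (gyniStrategy x) (gyniEvent y) := by
        rw [Finset.sum_pair hne, pointProbability, pointProbability, Set.indicator_of_mem h1,
          Set.indicator_of_mem h2, mul_one, mul_one]
    _ ≤ ∑ y, q y * pointProbability (gyniStrategy x) (gyniEvent y) :=
        Finset.sum_le_sum_of_subset_of_nonneg (Finset.subset_univ _) fun y _ _ =>
          mul_nonneg (hq y) (Set.indicator_nonneg (fun _ _ => zero_le_one) _)

theorem exists_nonContextual_gyniWin_le {n : ℕ} {q : (Fin n → Bool) → ℝ} (hq : ∀ x, 0 ≤ q x)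
    {P : Set (Fin n × Bool → Bool) → ℝ} (hP : (bellScenario n).IsProbabilityFunction P)
    (hQ : (bellScenario n).AdmitsJointQuantumMeasure P) :
    ∃ Pc : Set (Fin n × Bool → Bool) → ℝ, (bellScenario n).IsProbabilityFunction Pc ∧
      (bellScenario n).NonContextual Pc ∧ gyniWin q P ≤ gyniWin q Pc := by
  suffices h : ∃ x, gyniWin q P ≤ gyniWin q (pointProbability (gyniStrategy x)) by
    obtain ⟨x, hx⟩ := h
    exact ⟨_, isProbabilityFunction_pointProbability _ _, nonContextual_pointProbability _ _, hx⟩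
  obtain rfl | hn := eq_or_ne n 0
  · -- Without parties there is one event, the sure one.
    refine ⟨default, le_of_eq (Finset.sum_congr rfl fun x _ => ?_)⟩
    have h1 := sum_bellEvent hP x
    have h2 := sum_bellEvent (isProbabilityFunction_pointProbability (bellScenario 0)
      (gyniStrategy default)) x
    rw [Fintype.sum_subsingleton _ fun i => x (finRotate 0 i)] at h1 h2
    exact congrArg (q x * ·) (h1.trans h2.symm)
  · have : NeZero n := ⟨hn⟩
    obtain ⟨x, hx⟩ := Finite.exists_max fun x => q x + q (flipInputs n x)
    exact ⟨x, (gyniWin_le hq hP hQ hx).trans (le_gyniWin_gyniStrategy hq x)⟩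

/-! ### Bounds from joint quantum measures -/

theorem mainTheorem3 :
    -- (i) two independent copies of a Wright pentagon obey the quantum bound on KCBS
    (∀ {Ξ : Type*} (S : PartitionScenario Ξ) (A : ZMod 5 → Set Ξ), S.IsWrightPentagon A →
      ∀ (P : Set Ξ → ℝ) (P₂ : Set (Ξ × Ξ) → ℝ), S.IsTwoIndependentCopies P P₂ →
        (S.prod S).AdmitsJointQuantumMeasure P₂ →
        ∑ i, P (A i) ≤ Real.sqrt 5) ∧
    -- (ii) two independent copies of a CHSH scenario; the bound is 2.88303...
    (∀ (P : Set (Fin 2 × Bool → Bool) → ℝ)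
      (P₂ : Set ((Fin 2 × Bool → Bool) × (Fin 2 × Bool → Bool)) → ℝ),
      (bellScenario 2).IsTwoIndependentCopies P P₂ →
      ((bellScenario 2).prod (bellScenario 2)).AdmitsJointQuantumMeasure P₂ →
      ∀ x₀ y₀, |chsh P x₀ y₀| ≤ 4 * (Real.sqrt 10 - 1) / 3) ∧
    -- (iii) no advantage over non-contextual probability functions in the game
    (∀ (n : ℕ) (q : (Fin n → Bool) → ℝ), (∀ x, 0 ≤ q x) → ∑ x, q x = 1 →
      ∀ P : Set (Fin n × Bool → Bool) → ℝ, (bellScenario n).IsProbabilityFunction P →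
        (bellScenario n).AdmitsJointQuantumMeasure P →
        ∃ Pc : Set (Fin n × Bool → Bool) → ℝ, (bellScenario n).IsProbabilityFunction Pc ∧
          (bellScenario n).NonContextual Pc ∧ gyniWin q P ≤ gyniWin q Pc) := by
  refine ⟨fun S A hW P P₂ hP hQ => hW.sum_le_sqrt_five hP hQ,
    fun P P₂ hP hQ x₀ y₀ => abs_chsh_le hP hQ x₀ y₀,
    fun n q hq _ P hP hQ => exists_nonContextual_gyniWin_le hq hP hQ⟩
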